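/- A \emph{fractional dilate} is a map $\gamma:\mathbb{Z}\to[0,\infty)$ with finite support, and its \emph{size} is $\|\gamma\|=\inf_{0<p<1}\sum_{n\in\mathbb{Z}}\gamma(n)^p$. A \emph{fractional set} is a fractional dilate $\alpha$ with $\alpha(n)\le 1$ for all $n\in\mathbb{Z}$. For fractional sets $\alpha,\beta$ and an integer $k$, $\alpha+k\cdot\beta$ denotes the fractional dilate $(\alpha+k\cdot\beta)(n)=\sum_{i+kj=n}\alpha(i)\beta(j)$; write $\alpha+\alpha$ for $\alpha+1\cdot\alpha$ and $\alpha-\alpha$ for $\alpha+(-1)\cdot\alpha$. A fractional dilate $\gamma$ is \emph{spartan} if $\sum_{n\in\mathbb{Z}:\,\gamma(n)\ne 0}\gamma(n)\log\gamma(n)<0$. Theorem. There exists a fractional set $\alpha$ such that $\|\alpha\|>1$, $\alpha-\alpha$ is spartan, and $\|\alpha+\alpha\|\le\|\alpha\|^{1.7354}$. -/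

import Mathlib

open scoped NNReal

/-- A fractional dilate: a finitely supported map from `ℤ` to the non-negative reals. -/
abbrev FractionalDilate : Type := ℤ →₀ ℝ≥0

namespace FractionalDilate

/-- The size `‖γ‖ = inf_{0 < p < 1} ∑ₙ γ(n) ^ p` of a fractional dilate. Points outside the support
contribute `0 ^ p = 0`, so the sum runs over the support. -/
noncomputable def size (γ : FractionalDilate) : ℝ :=
  ⨅ p : Set.Ioo (0 : ℝ) 1, ∑ n ∈ γ.support, (γ n : ℝ) ^ (p : ℝ)

/-- A fractional set: a fractional dilate all of whose values are at most `1`. -/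
def IsFractionalSet (α : FractionalDilate) : Prop :=
  ∀ n : ℤ, α n ≤ 1

/-- The fractional dilate `α + k · β`, with `(α + k · β)(n) = ∑_{i + k j = n} α(i) β(j)`. -/
noncomputable def addDilate (α : FractionalDilate) (k : ℤ) (β : FractionalDilate) :
    FractionalDilate :=
  ∑ i ∈ α.support, ∑ j ∈ β.support, Finsupp.single (i + k * j) (α i * β j)

theorem addDilate_apply (α : FractionalDilate) (k : ℤ) (β : FractionalDilate) (n : ℤ) :
    addDilate α k β n =
      ∑ x ∈ (α.support ×ˢ β.support).filter (fun x => x.1 + k * x.2 = n), α x.1 * β x.2 := by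
  simp only [addDilate, Finsupp.finsetSum_apply, Finsupp.single_apply, Finset.sum_filter,
    Finset.sum_product]

/-- A fractional dilate is spartan if `∑_{n : γ(n) ≠ 0} γ(n) log γ(n) < 0`. -/
def IsSpartan (γ : FractionalDilate) : Prop :=
  ∑ n ∈ γ.support, (γ n : ℝ) * Real.log (γ n) < 0

end FractionalDilate

/-! Take X, Y independent with a law p on {0, …, M}, and h below both the entropy of X and half that
of X - Y. In the n-th power, let T be the sequences x of probability P(x) < exp(-nh) and mean digit
below m, just above the mean of X. Give x the weight exp(nh) P(x) < 1 and embed T in ℤ by digits.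
The size is at least the total mass, about exp(nh). A typical difference gets mass at most exp(2nh)
times its probability, which is exponentially small, so the difference is spartan
(`isSpartan_ofWeights_sub`); atypical pairs are negligible by `exists_chernoff_rate`. The size of
the sum is at most its support, whose digit sequences have mean at most 2m; `card_le_exp_of_sum_le`
counts them. `exists_isSpartan_sub_of_entropy` combines these, and `nearGeometricLaw` gives the
exponent. -/

open Finset Filter Topology

/-! ### Large deviations and base expansions -/

/-- Chernoff bound for a finite law `p`: a sum of `n` independent copies of a function with negative
mean is non-negative with exponentially small probability. -/
theorem exists_chernoff_rate {κ : Type*} [Fintype κ] (p g : κ → ℝ)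
    (hp : ∀ k, 0 ≤ p k) (hp1 : ∑ k, p k = 1) (hg : ∑ k, p k * g k < 0) :
    ∃ r : ℝ, 0 ≤ r ∧ r < 1 ∧ ∀ (n : ℕ) (A : Finset (Fin n → κ)),
      (∀ x ∈ A, 0 ≤ ∑ i, g (x i)) → ∑ x ∈ A, ∏ i, p (x i) ≤ r ^ n := by
  classical
  -- The moment generating function is 1 at 0 with negative slope there, so it drops below 1 at some
  -- s > 0; that value is the rate r.
  have hd : HasDerivAt (fun s : ℝ => ∑ k, p k * Real.exp (s * g k)) (∑ k, p k * g k) 0 := by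
    have : ∀ k ∈ (univ : Finset κ),
        HasDerivAt (fun s : ℝ => p k * Real.exp (s * g k)) (p k * g k) 0 := by
      intro k _
      have h1 : HasDerivAt (fun s : ℝ => s * g k) (g k) 0 := by
        simpa using (hasDerivAt_id (0 : ℝ)).mul_const (g k)
      simpa using (h1.exp).const_mul (p k)
    simpa using HasDerivAt.fun_sum this
  have hev : ∀ᶠ s in 𝓝[>] (0 : ℝ), ∑ k, p k * Real.exp (s * g k) < 1 := by
    have h := (hasDerivAt_iff_tendsto_slope.1 hd).mono_left
      (nhdsWithin_mono (0 : ℝ) (fun x (hx : 0 < x) => hx.ne'))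
    filter_upwards [h.eventually (gt_mem_nhds hg), self_mem_nhdsWithin] with s hs hs0
    have hs0 : 0 < s := hs0
    rw [slope_def_field] at hs
    simp only [zero_mul, Real.exp_zero, mul_one, hp1, sub_zero] at hs
    have := (div_lt_iff₀ hs0).1 hs
    linarith
  obtain ⟨s, hs1, hs0⟩ := (hev.and self_mem_nhdsWithin).exists
  have hs0 : 0 < s := hs0
  refine ⟨∑ k, p k * Real.exp (s * g k),
    sum_nonneg fun k _ => mul_nonneg (hp k) (Real.exp_pos _).le, hs1, fun n A hA => ?_⟩
  have hpow : (∑ k, p k * Real.exp (s * g k)) ^ n =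
      ∑ x : Fin n → κ, ∏ i, (p (x i) * Real.exp (s * g (x i))) := by
    have := Finset.prod_univ_sum (fun _ : Fin n => (univ : Finset κ))
      (fun _ k => p k * Real.exp (s * g k))
    simpa [Fintype.piFinset_univ] using this
  rw [hpow]
  calc ∑ x ∈ A, ∏ i, p (x i) ≤ ∑ x ∈ A, ∏ i, (p (x i) * Real.exp (s * g (x i))) := by
        refine sum_le_sum fun x hx => ?_
        rw [prod_mul_distrib, ← Real.exp_sum, ← mul_sum]
        exact le_mul_of_one_le_right (prod_nonneg fun i _ => hp _)
          (Real.one_le_exp (mul_nonneg hs0.le (hA x hx)))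
    _ ≤ _ := sum_le_sum_of_subset_of_nonneg (subset_univ _)
        fun x _ _ => prod_nonneg fun i _ => mul_nonneg (hp _) (Real.exp_pos _).le

theorem sum_pi_prod_eq_one {κ : Type*} [Fintype κ] (p : κ → ℝ) (hp1 : ∑ k, p k = 1) (n : ℕ) :
    ∑ x : Fin n → κ, ∏ i, p (x i) = 1 := by
  classical
  have := Finset.prod_univ_sum (fun _ : Fin n => (univ : Finset κ)) (fun _ k => p k)
  simpa [Fintype.piFinset_univ, hp1] using this.symm

/-- Uniqueness of signed base `b` expansions. -/
theorem eq_zero_of_sum_mul_pow_eq_zero (b : ℤ) : ∀ (n : ℕ) (e : Fin n → ℤ), (∀ i, |e i| < b) →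
    ∑ i, e i * b ^ (i : ℕ) = 0 → ∀ i, e i = 0
  | 0, _, _, _ => fun i => i.elim0
  | n + 1, e, he, h => by
    have hb : 0 < b := (abs_nonneg _).trans_lt (he 0)
    rw [Fin.sum_univ_succ] at h
    have h2 : ∑ i : Fin n, e i.succ * b ^ ((i.succ : Fin (n + 1)) : ℕ) =
        b * ∑ i : Fin n, e i.succ * b ^ (i : ℕ) := by
      rw [mul_sum]
      exact sum_congr rfl fun i _ => by rw [Fin.val_succ, pow_succ]; ring
    rw [h2] at h
    simp only [Fin.val_zero, pow_zero, mul_one] at h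
    have h0 : e 0 = 0 :=
      Int.eq_zero_of_abs_lt_dvd (m := b) ⟨-∑ i : Fin n, e i.succ * b ^ (i : ℕ), by linarith⟩ (he 0)
    rw [h0, zero_add] at h
    have h3 := (mul_eq_zero.1 h).resolve_left hb.ne'
    exact Fin.cases h0 (eq_zero_of_sum_mul_pow_eq_zero b n _ (fun i => he _) h3)

/-! ### Bounds on size, and dilates as pushforwards of weights -/

namespace FractionalDilate

theorem bddBelow_range_sum_rpow (γ : FractionalDilate) :
    BddBelow (Set.range fun p : Set.Ioo (0 : ℝ) 1 => ∑ n ∈ γ.support, (γ n : ℝ) ^ (p : ℝ)) :=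
  ⟨0, by rintro _ ⟨p, rfl⟩; exact sum_nonneg fun _ _ => Real.rpow_nonneg (NNReal.coe_nonneg _) _⟩

/-- As p tends to 0 from above, each nonzero value contributes a term tending to 1. -/
theorem size_le_card_support (γ : FractionalDilate) : γ.size ≤ γ.support.card := by
  have ht : Tendsto (fun p : ℝ => ∑ n ∈ γ.support, (γ n : ℝ) ^ p) (𝓝[>] 0)
      (𝓝 (γ.support.card : ℝ)) := by
    have : Tendsto (fun p : ℝ => ∑ n ∈ γ.support, (γ n : ℝ) ^ p) (𝓝 0)
        (𝓝 (∑ n ∈ γ.support, (γ n : ℝ) ^ (0 : ℝ))) := by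
      refine tendsto_finsetSum _ fun n hn => ?_
      have hn' : (γ n : ℝ) ≠ 0 := by simpa using hn
      exact (Real.continuousAt_const_rpow hn').tendsto
    simp only [Real.rpow_zero, sum_const, nsmul_eq_mul, mul_one] at this
    exact this.mono_left nhdsWithin_le_nhds
  refine ge_of_tendsto ht ?_
  filter_upwards [Ioo_mem_nhdsGT (zero_lt_one' ℝ)] with p hp
  exact ciInf_le γ.bddBelow_range_sum_rpow ⟨p, hp⟩

/-- For 0 < a ≤ 1 and p < 1, a ≤ a ^ p. -/
theorem IsFractionalSet.sum_le_size {α : FractionalDilate} (hα : α.IsFractionalSet) :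
    ∑ n ∈ α.support, (α n : ℝ) ≤ α.size := by
  have : Nonempty (Set.Ioo (0 : ℝ) 1) := ⟨⟨1 / 2, by norm_num, by norm_num⟩⟩
  refine le_ciInf fun p => sum_le_sum fun n hn => ?_
  have h0 : (0 : ℝ) < α n := NNReal.coe_pos.2 (pos_iff_ne_zero.2 (by simpa using hn))
  have h1 : (α n : ℝ) ≤ 1 := by exact_mod_cast hα n
  simpa using Real.rpow_le_rpow_of_exponent_ge h0 h1 p.2.2.le

/-- The fractional dilate giving mass `a x` to the image under `φ` of each point `x` of `T`. -/
noncomputable def ofWeights {Ω : Type*} (T : Finset Ω) (φ : Ω → ℤ) (a : Ω → ℝ≥0) :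
    FractionalDilate :=
  ∑ x ∈ T, Finsupp.single (φ x) (a x)

section ofWeights

variable {Ω : Type*} (T : Finset Ω) (φ : Ω → ℤ) (a : Ω → ℝ≥0)

theorem ofWeights_apply (k : ℤ) :
    ofWeights T φ a k = ∑ x ∈ T with φ x = k, a x := by
  simp [ofWeights, Finsupp.finsetSum_apply, Finsupp.single_apply, sum_filter]

/-- Used with f = 1 for total mass and with f the logarithm of the dilate itself for spartanness;
`φ` need not be injective. -/
theorem sum_support_ofWeights_mul (f : ℤ → ℝ) :
    ∑ k ∈ (ofWeights T φ a).support, (ofWeights T φ a k : ℝ) * f k = ∑ x ∈ T, a x * f (φ x) := by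
  have := Finsupp.sum_finsetSum_index (s := T) (g := fun x => Finsupp.single (φ x) (a x))
    (h := fun k (v : ℝ≥0) => (v : ℝ) * f k) (by simp) (by intros; push_cast; ring)
  rw [ofWeights]
  refine Eq.trans this.symm (sum_congr rfl fun x _ => ?_)
  rw [Finsupp.sum_single_index (by simp)]

theorem support_ofWeights_subset : (ofWeights T φ a).support ⊆ T.image φ := by
  intro k hk
  by_contra h
  refine Finsupp.mem_support_iff.1 hk ?_
  rw [ofWeights_apply]
  refine sum_eq_zero fun x hx => ?_
  rw [mem_filter] at hx
  exact absurd (mem_image.2 ⟨x, hx.1, hx.2⟩) h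

theorem addDilate_ofWeights (k : ℤ) :
    (ofWeights T φ a).addDilate k (ofWeights T φ a) =
      ofWeights (T ×ˢ T) (fun z => φ z.1 + k * φ z.2) (fun z => a z.1 * a z.2) := by
  have inner : ∀ (i : ℤ) (u : ℝ≥0),
      ((ofWeights T φ a).sum fun j v => Finsupp.single (i + k * j) (u * v)) =
        ∑ y ∈ T, Finsupp.single (i + k * φ y) (u * a y) := by
    intro i u
    rw [ofWeights, ← Finsupp.sum_finsetSum_index (by simp)
      (by intros; rw [mul_add, Finsupp.single_add])]
    exact sum_congr rfl fun y _ => Finsupp.sum_single_index (by simp)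
  have h1 : (ofWeights T φ a).addDilate k (ofWeights T φ a) =
      (ofWeights T φ a).sum fun i u => ∑ y ∈ T, Finsupp.single (i + k * φ y) (u * a y) :=
    sum_congr rfl fun i _ => inner i _
  rw [h1]
  conv_lhs => rw [ofWeights]
  rw [← Finsupp.sum_finsetSum_index (by simp)
      (by intros; rw [← sum_add_distrib]; simp [add_mul]), ofWeights, sum_product]
  exact sum_congr rfl fun x _ => Finsupp.sum_single_index (by simp)

end ofWeights

end FractionalDilate

/-! ### Digit embedding of product laws and counting of sums -/

section Product

variable {M : ℕ}

/-- The law of `X - Y` for independent `X`, `Y` with law `p`. -/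
noncomputable def diffLaw (p : Fin (M + 1) → ℝ) (d : ℤ) : ℝ :=
  ∑ z : Fin (M + 1) × Fin (M + 1) with (z.1 : ℤ) - (z.2 : ℤ) = d, p z.1 * p z.2

theorem diffLaw_pos {p : Fin (M + 1) → ℝ} (hp : ∀ i, 0 < p i) (i j : Fin (M + 1)) :
    0 < diffLaw p ((i : ℤ) - (j : ℤ)) :=
  sum_pos (fun z _ => mul_pos (hp z.1) (hp z.2)) ⟨(i, j), by simp⟩

theorem sum_prod_mul_eq_one {κ : Type*} [Fintype κ] {p : κ → ℝ} (hp1 : ∑ i, p i = 1) :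
    ∑ z : κ × κ, p z.1 * p z.2 = 1 := by
  rw [Fintype.sum_prod_type]
  simp [← mul_sum, hp1]

theorem diffLaw_le_one {p : Fin (M + 1) → ℝ} (hp : ∀ i, 0 < p i) (hp1 : ∑ i, p i = 1) (d : ℤ) :
    diffLaw p d ≤ 1 := by
  rw [← sum_prod_mul_eq_one hp1]
  exact sum_le_sum_of_subset_of_nonneg (subset_univ _)
    fun z _ _ => (mul_pos (hp z.1) (hp z.2)).le

/-- The integer whose base `2 * M + 1` digits are the entries of `x`. -/
def digitEmbed {n : ℕ} (x : Fin n → Fin (M + 1)) : ℤ :=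
  ∑ i, ((x i : ℕ) : ℤ) * (2 * M + 1 : ℤ) ^ (i : ℕ)

/-- Two digit differences differ by at most 2M in absolute value, less than the base 2M + 1, so
nothing carries. -/
theorem sub_eq_sub_of_digitEmbed {n : ℕ} {x y x' y' : Fin n → Fin (M + 1)}
    (h : digitEmbed x - digitEmbed y = digitEmbed x' - digitEmbed y') (i : Fin n) :
    (x i : ℤ) - (y i : ℤ) = (x' i : ℤ) - (y' i : ℤ) := by
  have key := eq_zero_of_sum_mul_pow_eq_zero (2 * M + 1) n
    (fun i => ((x i : ℤ) - (y i : ℤ)) - ((x' i : ℤ) - (y' i : ℤ))) (fun i => by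
      have h1 := (x i).2
      have h2 := (y i).2
      have h3 := (x' i).2
      have h4 := (y' i).2
      rw [abs_lt]
      omega) (by
      simp only [digitEmbed] at h
      simp only [sub_mul, sum_sub_distrib]
      linarith) i
  linarith

theorem digitEmbed_injective {n : ℕ} :
    Function.Injective (digitEmbed : (Fin n → Fin (M + 1)) → ℤ) := by
  intro x y h
  funext i
  have := sub_eq_sub_of_digitEmbed (x := x) (y := x) (x' := y) (y' := x) (by rw [h]) i
  have h2 : (x i : ℕ) = y i := by omega
  exact Fin.ext h2

/-- A pair of sequences as a sequence of pairs. -/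
def zipEmbedding (n : ℕ) (κ : Type*) : (Fin n → κ) × (Fin n → κ) ↪ (Fin n → κ × κ) :=
  (Equiv.arrowProdEquivProdArrow (Fin n) (fun _ => κ) (fun _ => κ)).symm.toEmbedding

@[simp] theorem zipEmbedding_apply {n : ℕ} {κ : Type*} (z : (Fin n → κ) × (Fin n → κ))
    (i : Fin n) : zipEmbedding n κ z i = (z.1 i, z.2 i) := rfl

theorem sum_map_zipEmbedding {n : ℕ} {κ : Type*} (p : κ → ℝ)
    (A : Finset ((Fin n → κ) × (Fin n → κ))) :
    ∑ w ∈ A.map (zipEmbedding n κ), ∏ i, (p (w i).1 * p (w i).2) =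
      ∑ z ∈ A, (∏ i, p (z.1 i)) * ∏ i, p (z.2 i) := by
  simp [sum_map, prod_mul_distrib]

/-- The pairs in `A` with the same image difference as `z` have mass at most the probability that
all coordinate differences agree. -/
theorem sum_filter_digitEmbed_sub_le {n : ℕ} {p : Fin (M + 1) → ℝ} (hp : ∀ i, 0 < p i)
    (A : Finset ((Fin n → Fin (M + 1)) × (Fin n → Fin (M + 1)))) (x y : Fin n → Fin (M + 1)) :
    ∑ z ∈ A with digitEmbed z.1 - digitEmbed z.2 = digitEmbed x - digitEmbed y,
        (∏ i, p (z.1 i)) * ∏ i, p (z.2 i) ≤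
      ∏ i, diffLaw p ((x i : ℤ) - (y i : ℤ)) := by
  simp only [diffLaw]
  -- The product of the `diffLaw` sums expands into a sum over sequences of pairs, among which the
  -- filtered pairs lie.
  rw [Finset.prod_univ_sum, ← sum_map_zipEmbedding]
  refine sum_le_sum_of_subset_of_nonneg (fun w hw => ?_)
    fun w _ _ => prod_nonneg fun i _ => (mul_pos (hp _) (hp _)).le
  simp only [Finset.mem_map, mem_filter] at hw
  obtain ⟨z, ⟨_, hz⟩, rfl⟩ := hw
  simp only [Fintype.mem_piFinset, mem_filter, mem_univ, true_and, zipEmbedding_apply]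
  exact fun i => sub_eq_sub_of_digitEmbed hz i

/-- Exponential bound for the number of sequences in `{0, …, N - 1}` with a given bound on the sum. -/
theorem card_le_exp_of_sum_le {N n : ℕ} {b w : ℝ} (hN : 0 < N) (hw0 : 0 < w) (hw1 : w < 1)
    (U : Finset (Fin n → Fin N)) (hU : ∀ u ∈ U, ∑ i, ((u i : ℕ) : ℝ) ≤ n * b) :
    (U.card : ℝ) ≤
      Real.exp (n * (b * -Real.log w + Real.log (∑ k : Fin N, w ^ (k : ℕ)))) := by
  classical
  have : Nonempty (Fin N) := ⟨⟨0, hN⟩⟩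
  have hpos : 0 < ∑ k : Fin N, w ^ (k : ℕ) :=
    sum_pos (fun _ _ => pow_pos hw0 _) univ_nonempty
  have hlog : Real.log w < 0 := Real.log_neg hw0 hw1
  have hpow : (∑ k : Fin N, w ^ (k : ℕ)) ^ n = ∑ u : Fin n → Fin N, ∏ i, w ^ (u i : ℕ) := by
    have := Finset.prod_univ_sum (fun _ : Fin n => (univ : Finset (Fin N)))
      (fun _ k => w ^ (k : ℕ))
    simpa only [prod_const, card_univ, Fintype.card_fin, Fintype.piFinset_univ] using this
  have hterm : ∀ u : Fin n → Fin N,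
      ∏ i, w ^ (u i : ℕ) = Real.exp (Real.log w * ∑ i, ((u i : ℕ) : ℝ)) := by
    intro u
    rw [mul_sum, Real.exp_sum]
    refine prod_congr rfl fun i _ => ?_
    rw [mul_comm, Real.exp_nat_mul, Real.exp_log hw0]
  -- Exponential Markov: weighting by w to the digit sum, rescaled by w ^ (-nb), counts each member
  -- of U at least once.
  have hone : ∀ u ∈ U, 1 ≤ Real.exp (n * (b * -Real.log w)) * ∏ i, w ^ (u i : ℕ) := by
    intro u hu
    rw [hterm, ← Real.exp_add]
    refine Real.one_le_exp ?_
    have := mul_le_mul_of_nonneg_right (hU u hu) (neg_nonneg.2 hlog.le)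
    linarith
  have hexp : Real.exp (n * (b * -Real.log w + Real.log (∑ k : Fin N, w ^ (k : ℕ)))) =
      Real.exp (n * (b * -Real.log w)) * (∑ k : Fin N, w ^ (k : ℕ)) ^ n := by
    rw [mul_add, Real.exp_add, Real.exp_nat_mul (Real.log _), Real.exp_log hpos]
  rw [hexp, hpow, mul_sum]
  have hcard : (U.card : ℝ) = ∑ u ∈ U, (1 : ℝ) := by simp
  rw [hcard]
  exact (sum_le_sum hone).trans (sum_le_sum_of_subset_of_nonneg (subset_univ _) fun u _ _ =>
    mul_nonneg (Real.exp_pos _).le (prod_nonneg fun i _ => (pow_pos hw0 _).le))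

/-- The coordinatewise sum of a pair of sequences. -/
def addDigits {n : ℕ} (z : (Fin n → Fin (M + 1)) × (Fin n → Fin (M + 1))) :
    Fin n → Fin (2 * M + 1) :=
  fun i => ⟨z.1 i + z.2 i, by have := (z.1 i).2; have := (z.2 i).2; omega⟩

/-- The image of pairs of sequences with sums at most `n * m` under addition is exponentially
bounded. -/
theorem card_image_digitEmbed_add_le {n : ℕ} {m w : ℝ} (hw0 : 0 < w) (hw1 : w < 1)
    (T : Finset (Fin n → Fin (M + 1))) (hT : ∀ x ∈ T, ∑ i, ((x i : ℕ) : ℝ) ≤ n * m) :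
    (((T ×ˢ T).image fun z => digitEmbed z.1 + 1 * digitEmbed z.2).card : ℝ) ≤
      Real.exp (n * (2 * m * -Real.log w + Real.log (∑ k : Fin (2 * M + 1), w ^ (k : ℕ)))) := by
  classical
  have hU : (T ×ˢ T).image (fun z => digitEmbed z.1 + 1 * digitEmbed z.2) =
      ((T ×ˢ T).image addDigits).image
        fun u => ∑ i : Fin n, ((u i : ℕ) : ℤ) * (2 * M + 1 : ℤ) ^ (i : ℕ) := by
    rw [image_image]
    refine image_congr fun z _ => ?_
    simp only [Function.comp_apply, addDigits, digitEmbed, Nat.cast_add, add_mul, sum_add_distrib,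
      one_mul]
  rw [hU]
  refine le_trans (by exact_mod_cast card_image_le)
    (card_le_exp_of_sum_le (Nat.succ_pos _) hw0 hw1 ((T ×ˢ T).image addDigits) fun u hu => ?_)
  obtain ⟨z, hz, rfl⟩ := mem_image.1 hu
  rw [mem_product] at hz
  have h1 := hT _ hz.1
  have h2 := hT _ hz.2
  simp only [addDigits, Nat.cast_add, sum_add_distrib]
  linarith

end Product

/-! ### The typical-sequence construction -/

namespace FractionalDilate

/-- Each pair contributes its mass times the log of the dilate at its difference. That log is below
-nη off the atypical pairs of `hbad`, and at most 2nh on them. -/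
theorem isSpartan_ofWeights_sub {M n : ℕ} {p : Fin (M + 1) → ℝ} (hp : ∀ i, 0 < p i)
    (hp1 : ∑ i, p i = 1) {h η ε : ℝ} (hh : 0 ≤ h) (hη : 0 ≤ η) (hn : 0 < n)
    (T : Finset (Fin n → Fin (M + 1))) (hT : 1 / 2 ≤ ∑ x ∈ T, ∏ i, p (x i))
    (hε : (2 * h + η) * ε < η / 4)
    (hbad : ∑ z ∈ T ×ˢ T with
        0 ≤ ∑ i, (Real.log (diffLaw p ((z.1 i : ℤ) - (z.2 i : ℤ))) + 2 * h + η),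
      (∏ i, p (z.1 i)) * ∏ i, p (z.2 i) ≤ ε) :
    ((ofWeights T digitEmbed fun x => Real.toNNReal (Real.exp (n * h) * ∏ i, p (x i))).addDilate
      (-1) (ofWeights T digitEmbed fun x =>
        Real.toNNReal (Real.exp (n * h) * ∏ i, p (x i)))).IsSpartan := by
  classical
  have hP : ∀ x : Fin n → Fin (M + 1), 0 < ∏ i, p (x i) := fun x => prod_pos fun i _ => hp _
  set c := Real.exp (n * h) with hc
  have hc0 : 0 < c := Real.exp_pos _
  have hcoe : ∀ x : Fin n → Fin (M + 1),
      ((Real.toNNReal (c * ∏ i, p (x i)) : ℝ≥0) : ℝ) = c * ∏ i, p (x i) :=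
    fun x => Real.coe_toNNReal _ (mul_pos hc0 (hP x)).le
  rw [addDilate_ofWeights]
  set γ := ofWeights (T ×ˢ T)
    (fun z : (Fin n → Fin (M + 1)) × (Fin n → Fin (M + 1)) => digitEmbed z.1 + -1 * digitEmbed z.2)
    (fun z => Real.toNNReal (c * ∏ i, p (z.1 i)) * Real.toNNReal (c * ∏ i, p (z.2 i))) with hγ
  let W : (Fin n → Fin (M + 1)) × (Fin n → Fin (M + 1)) → ℝ := fun z =>
    ∑ i, (Real.log (diffLaw p ((z.1 i : ℤ) - (z.2 i : ℤ))) + 2 * h)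
  have hγapp : ∀ k, (γ k : ℝ) = c ^ 2 * ∑ z ∈ T ×ˢ T with digitEmbed z.1 - digitEmbed z.2 = k,
      (∏ i, p (z.1 i)) * ∏ i, p (z.2 i) := by
    intro k
    rw [hγ, ofWeights_apply, NNReal.coe_sum, mul_sum]
    refine sum_congr (by simp only [neg_mul, one_mul, sub_eq_add_neg]) fun z _ => ?_
    rw [NNReal.coe_mul, hcoe, hcoe]
    ring
  have hlog : ∀ z ∈ T ×ˢ T, Real.log (γ (digitEmbed z.1 + -1 * digitEmbed z.2)) ≤ W z := by
    intro z hz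
    rw [show digitEmbed z.1 + -1 * digitEmbed z.2 = digitEmbed z.1 - digitEmbed z.2 by ring]
    have hpos : 0 < (γ (digitEmbed z.1 - digitEmbed z.2) : ℝ) := by
      rw [hγapp]
      exact mul_pos (pow_pos hc0 2) (sum_pos (fun z _ => mul_pos (hP _) (hP _))
        ⟨z, mem_filter.2 ⟨hz, rfl⟩⟩)
    have hle : (γ (digitEmbed z.1 - digitEmbed z.2) : ℝ) ≤ Real.exp (W z) := by
      rw [hγapp]
      have hexp : Real.exp (W z) = c ^ 2 * ∏ i, diffLaw p ((z.1 i : ℤ) - (z.2 i : ℤ)) := by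
        simp only [W, sum_add_distrib, Real.exp_add, Real.exp_sum]
        rw [prod_congr rfl fun i _ => Real.exp_log (diffLaw_pos hp (z.1 i) (z.2 i)), hc, mul_comm,
          prod_const, card_univ, Fintype.card_fin, ← Real.exp_nat_mul, ← Real.exp_nat_mul]
        congr 2
        push_cast
        ring
      rw [hexp]
      exact mul_le_mul_of_nonneg_left (sum_filter_digitEmbed_sub_le hp _ _ _) (pow_pos hc0 2).le
    exact (Real.log_le_iff_le_exp hpos).2 hle
  -- On atypical pairs only `diffLaw` ≤ 1 is used: the bound is 2nh = -nη + n(2h + η).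
  have hW : ∀ z, W z ≤ -(n * η) + if 0 ≤ ∑ i, (Real.log (diffLaw p ((z.1 i : ℤ) - (z.2 i : ℤ))) +
      2 * h + η) then n * (2 * h + η) else 0 := by
    intro z
    have hs : ∑ i, (Real.log (diffLaw p ((z.1 i : ℤ) - (z.2 i : ℤ))) + 2 * h + η) =
        W z + n * η := by
      simp [W, sum_add_distrib]
    rw [hs]
    split_ifs with hb
    · have : W z ≤ ∑ _i : Fin n, 2 * h := by
        refine sum_le_sum fun i _ => ?_
        have := Real.log_nonpos (diffLaw_pos hp (z.1 i) (z.2 i)).le (diffLaw_le_one hp hp1 _)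
        linarith
      simp only [sum_const, card_univ, Fintype.card_fin, nsmul_eq_mul] at this
      linarith
    · linarith
  rw [IsSpartan, hγ, sum_support_ofWeights_mul, ← hγ]
  have hT2 : ∑ z ∈ T ×ˢ T, (∏ i, p (z.1 i)) * ∏ i, p (z.2 i) = (∑ x ∈ T, ∏ i, p (x i)) ^ 2 := by
    rw [sum_product, sq, sum_mul_sum]
  have hn' : (0 : ℝ) < n := by exact_mod_cast hn
  calc _ ≤ ∑ z ∈ T ×ˢ T, c ^ 2 * (((∏ i, p (z.1 i)) * ∏ i, p (z.2 i)) *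
        (-(n * η) + if 0 ≤ ∑ i, (Real.log (diffLaw p ((z.1 i : ℤ) - (z.2 i : ℤ))) +
          2 * h + η) then n * (2 * h + η) else 0)) := by
        refine sum_le_sum fun z hz => ?_
        rw [NNReal.coe_mul, hcoe, hcoe]
        have h1 := (hlog z hz).trans (hW z)
        have h2 := mul_le_mul_of_nonneg_left h1
          (mul_pos (mul_pos hc0 (hP z.1)) (mul_pos hc0 (hP z.2))).le
        refine h2.trans_eq ?_
        ring
    _ = c ^ 2 * (-(n * η) * (∑ x ∈ T, ∏ i, p (x i)) ^ 2 + n * (2 * h + η) *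
        ∑ z ∈ T ×ˢ T with
          0 ≤ ∑ i, (Real.log (diffLaw p ((z.1 i : ℤ) - (z.2 i : ℤ))) + 2 * h + η),
          (∏ i, p (z.1 i)) * ∏ i, p (z.2 i)) := by
        rw [← mul_sum]
        congr 1
        rw [← hT2, sum_filter, mul_sum, mul_sum, ← sum_add_distrib]
        refine sum_congr rfl fun z _ => ?_
        split_ifs <;> ring
    _ < 0 := by
        refine mul_neg_of_pos_of_neg (pow_pos hc0 2) ?_
        have h1 : (1 / 4 : ℝ) ≤ (∑ x ∈ T, ∏ i, p (x i)) ^ 2 := by nlinarith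
        have h2 := mul_le_mul_of_nonneg_left hbad (by positivity : 0 ≤ n * (2 * h + η))
        have h3 := mul_le_mul_of_nonneg_left h1 (by positivity : 0 ≤ n * η)
        have h4 := mul_lt_mul_of_pos_left hε hn'
        linarith

/-- A law `p` on `{0, …, M}` whose difference entropy exceeds `2 * h` gives, via typical sequences in
a high power, a fractional set with spartan difference and with small sum. -/
theorem exists_isSpartan_sub_of_entropy {M : ℕ} {p : Fin (M + 1) → ℝ} (hp : ∀ i, 0 < p i)
    (hp1 : ∑ i, p i = 1) {h m w s : ℝ} (hh : 0 < h) (hs : 0 < s) (hw0 : 0 < w) (hw1 : w < 1)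
    (hmean : ∑ i, p i * (i : ℕ) < m) (hent : ∑ i, p i * Real.log (p i) < -h)
    (hdiff : ∑ z : Fin (M + 1) × Fin (M + 1),
      p z.1 * p z.2 * Real.log (diffLaw p ((z.1 : ℤ) - (z.2 : ℤ))) < -(2 * h))
    (hsum : 2 * m * -Real.log w + Real.log (∑ k : Fin (2 * M + 1), w ^ (k : ℕ)) < s * h) :
    ∃ α : FractionalDilate, α.IsFractionalSet ∧ 1 < α.size ∧ (α.addDilate (-1) α).IsSpartan ∧
      (α.addDilate 1 α).size ≤ α.size ^ s := by
  classical
  set K := 2 * m * -Real.log w + Real.log (∑ k : Fin (2 * M + 1), w ^ (k : ℕ)) with hK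
  set D := ∑ z : Fin (M + 1) × Fin (M + 1),
      p z.1 * p z.2 * Real.log (diffLaw p ((z.1 : ℤ) - (z.2 : ℤ))) with hD
  obtain ⟨η, hη, hDη⟩ : ∃ η : ℝ, 0 < η ∧ D + 2 * h + η < 0 :=
    ⟨-(D + 2 * h) / 2, by linarith, by linarith⟩
  obtain ⟨r₁, h₁, h₁', hr₁⟩ := exists_chernoff_rate p (fun i => ((i : ℕ) : ℝ) - m)
    (fun i => (hp i).le) hp1 (by simp only [mul_sub, sum_sub_distrib, ← sum_mul, hp1]; linarith)
  obtain ⟨r₂, h₂, h₂', hr₂⟩ := exists_chernoff_rate p (fun i => Real.log (p i) + h)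
    (fun i => (hp i).le) hp1 (by simp only [mul_add, sum_add_distrib, ← sum_mul, hp1]; linarith)
  obtain ⟨r₃, h₃, h₃', hr₃⟩ := exists_chernoff_rate
    (fun z : Fin (M + 1) × Fin (M + 1) => p z.1 * p z.2)
    (fun z => Real.log (diffLaw p ((z.1 : ℤ) - (z.2 : ℤ))) + 2 * h + η)
    (fun z => (mul_pos (hp _) (hp _)).le) (sum_prod_mul_eq_one hp1) (by
      simp only [mul_add, sum_add_distrib, ← sum_mul, sum_prod_mul_eq_one hp1]
      linarith)
  have t₁ := tendsto_pow_atTop_nhds_zero_of_lt_one h₁ h₁'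
  have t₂ := tendsto_pow_atTop_nhds_zero_of_lt_one h₂ h₂'
  have t₃ := (tendsto_pow_atTop_nhds_zero_of_lt_one h₃ h₃').const_mul (2 * h + η)
  rw [mul_zero] at t₃
  have tn : ∀ b : ℝ, 0 < b → Tendsto (fun n : ℕ => (n : ℝ) * b) atTop atTop := fun b hb =>
    tendsto_natCast_atTop_atTop.atTop_mul_const hb
  -- `e₁`, `e₂` leave T mass at least 1/2; `e₃` makes atypical differences negligible; `e₄`, `e₅`
  -- absorb the log 2 lost to that factor 1/2.
  obtain ⟨n, e₁, e₂, e₃, e₄, e₅, hn⟩ := ((t₁.eventually (gt_mem_nhds (show (0 : ℝ) < 1 / 4 by norm_num))).and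
    ((t₂.eventually (gt_mem_nhds (show (0 : ℝ) < 1 / 4 by norm_num))).and
    ((t₃.eventually (gt_mem_nhds (show 0 < η / 4 by linarith))).and
    (((tn h hh).eventually_gt_atTop (Real.log 2)).and
    (((tn (s * h - K) (by linarith)).eventually_ge_atTop (s * Real.log 2)).and
    (eventually_gt_atTop 0)))))).exists
  have hP : ∀ x : Fin n → Fin (M + 1), 0 < ∏ i, p (x i) := fun x => prod_pos fun i _ => hp _
  let T : Finset (Fin n → Fin (M + 1)) := {x | ∑ i, (((x i : ℕ) : ℝ) - m) < 0 ∧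
    ∑ i, (Real.log (p (x i)) + h) < 0}
  have hT : 1 / 2 ≤ ∑ x ∈ T, ∏ i, p (x i) := by
    have b₁ := hr₁ n {x | 0 ≤ ∑ i, (((x i : ℕ) : ℝ) - m)} (by simp)
    have b₂ := hr₂ n {x | 0 ≤ ∑ i, (Real.log (p (x i)) + h)} (by simp)
    have hall := sum_pi_prod_eq_one p hp1 n
    have hle : ∑ x : Fin n → Fin (M + 1), ∏ i, p (x i) ≤ ∑ x ∈ T, ∏ i, p (x i) +
        (∑ x : Fin n → Fin (M + 1) with 0 ≤ ∑ i, (((x i : ℕ) : ℝ) - m), ∏ i, p (x i) +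
          ∑ x : Fin n → Fin (M + 1) with 0 ≤ ∑ i, (Real.log (p (x i)) + h), ∏ i, p (x i)) := by
      simp only [T, sum_filter, ← sum_add_distrib]
      refine sum_le_sum fun x _ => ?_
      have := (hP x).le
      by_cases c₁ : 0 ≤ ∑ i, (((x i : ℕ) : ℝ) - m)
      · rw [if_pos c₁]
        split_ifs <;> linarith
      by_cases c₂ : 0 ≤ ∑ i, (Real.log (p (x i)) + h)
      · rw [if_pos c₂]
        split_ifs <;> linarith
      rw [if_pos ⟨not_le.1 c₁, not_le.1 c₂⟩, if_neg c₁, if_neg c₂]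
      linarith
    linarith
  set c := Real.exp (n * h) with hc
  have hc0 : 0 < c := Real.exp_pos _
  have hcoe : ∀ x : Fin n → Fin (M + 1),
      ((Real.toNNReal (c * ∏ i, p (x i)) : ℝ≥0) : ℝ) = c * ∏ i, p (x i) :=
    fun x => Real.coe_toNNReal _ (mul_pos hc0 (hP x)).le
  let a : (Fin n → Fin (M + 1)) → ℝ≥0 := fun x => Real.toNNReal (c * ∏ i, p (x i))
  have hfrac : (ofWeights T digitEmbed a).IsFractionalSet := by
    intro k
    rw [ofWeights_apply]
    rcases (T.filter fun x => digitEmbed x = k).eq_empty_or_nonempty with he | ⟨x, hx⟩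
    · simp [he]
    · rw [mem_filter] at hx
      have hsub : (T.filter fun x => digitEmbed x = k) ⊆ {x} := fun y hy => by
        rw [mem_filter] at hy
        exact mem_singleton.2 (digitEmbed_injective (hy.2.trans hx.2.symm))
      refine (sum_le_sum_of_subset hsub).trans ?_
      rw [sum_singleton]
      refine Real.toNNReal_le_one.2 ?_
      have hx2 : ∑ i, (Real.log (p (x i)) + h) < 0 := (mem_filter.1 hx.1).2.2
      have : c * ∏ i, p (x i) = Real.exp (∑ i, (Real.log (p (x i)) + h)) := by
        rw [sum_add_distrib, Real.exp_add, Real.exp_sum,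
          prod_congr rfl fun i _ => Real.exp_log (hp (x i)), hc, mul_comm]
        simp
      rw [this]
      exact Real.exp_le_one_iff.2 hx2.le
  have hsize : Real.exp (n * h - Real.log 2) ≤ (ofWeights T digitEmbed a).size := by
    refine le_trans ?_ hfrac.sum_le_size
    have := sum_support_ofWeights_mul T digitEmbed a (fun _ => 1)
    simp only [mul_one] at this
    rw [this, sum_congr rfl fun x _ => hcoe x, ← mul_sum, Real.exp_sub, Real.exp_log two_pos, ← hc]
    nlinarith
  refine ⟨ofWeights T digitEmbed a, hfrac, ?_, ?_, ?_⟩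
  · exact (Real.one_lt_exp_iff.2 (by linarith)).trans_le hsize
  · refine isSpartan_ofWeights_sub hp hp1 hh.le hη.le hn T hT e₃ ?_
    rw [← sum_map_zipEmbedding]
    refine hr₃ n _ fun w hw => ?_
    obtain ⟨z, hz, rfl⟩ := Finset.mem_map.1 hw
    exact (mem_filter.1 hz).2
  · rw [addDilate_ofWeights]
    calc _ ≤ _ := size_le_card_support _
      _ ≤ (((T ×ˢ T).image fun z => digitEmbed z.1 + 1 * digitEmbed z.2).card : ℝ) := by
          exact_mod_cast card_le_card (support_ofWeights_subset _ _ _)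
      _ ≤ Real.exp (n * K) := by
          refine card_image_digitEmbed_add_le hw0 hw1 T fun x hx => ?_
          have := (mem_filter.1 hx).2.1
          simp only [sum_sub_distrib, sum_const, card_univ, Fintype.card_fin, nsmul_eq_mul] at this
          linarith
      _ ≤ Real.exp (n * h - Real.log 2) ^ s := by
          rw [← Real.exp_mul]
          refine Real.exp_le_exp.2 ?_
          linarith
      _ ≤ _ := Real.rpow_le_rpow (Real.exp_pos _).le hsize hs.le

end FractionalDilate

/-! ### Numerical verification for an explicit law -/

/-- Reduces a logarithm estimate to comparing rational powers, with a / b approximating log₂ x. -/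
theorem log_le_div_mul_log_two {x : ℝ} (hx : 0 < x) {a b : ℕ} (hb : 0 < b)
    (h : x ^ b ≤ 2 ^ a) : Real.log x ≤ a / b * Real.log 2 := by
  have h1 := Real.log_le_log (pow_pos hx b) h
  rw [Real.log_pow, Real.log_pow] at h1
  have hb' : (0 : ℝ) < b := by exact_mod_cast hb
  rw [div_mul_eq_mul_div, le_div_iff₀ hb']
  linarith

theorem log_le_neg_div_mul_log_two {x : ℝ} (hx : 0 < x) {a b : ℕ} (hb : 0 < b)
    (h : x ^ b * 2 ^ a ≤ 1) : Real.log x ≤ -(a / b * Real.log 2) := by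
  have h1 := Real.log_le_log (by positivity) h
  rw [Real.log_mul (by positivity) (by positivity), Real.log_pow, Real.log_pow, Real.log_one] at h1
  have hb' : (0 : ℝ) < b := by exact_mod_cast hb
  rw [div_mul_eq_mul_div, ← neg_div, le_div_iff₀ hb']
  linarith

/-- A law on `{0, 1, 2, 3}`, close to a truncated geometric law. -/
noncomputable def nearGeometricLaw : Fin (3 + 1) → ℝ :=
  ![1868 / 2000, 120 / 2000, 11 / 2000, 1 / 2000]

theorem sum_fin_three_add_one (f : Fin (3 + 1) → ℝ) : ∑ i, f i = f 0 + f 1 + f 2 + f 3 :=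
  Fin.sum_univ_four f

theorem nearGeometricLaw_apply :
    nearGeometricLaw 0 = 1868 / 2000 ∧ nearGeometricLaw 1 = 120 / 2000 ∧
      nearGeometricLaw 2 = 11 / 2000 ∧ nearGeometricLaw 3 = 1 / 2000 :=
  ⟨rfl, rfl, rfl, rfl⟩

theorem val_fin_three_add_one :
    ((0 : Fin (3 + 1)) : ℕ) = 0 ∧ ((1 : Fin (3 + 1)) : ℕ) = 1 ∧ ((2 : Fin (3 + 1)) : ℕ) = 2 ∧
      ((3 : Fin (3 + 1)) : ℕ) = 3 :=
  ⟨rfl, rfl, rfl, rfl⟩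

theorem diffLaw_nearGeometricLaw :
    diffLaw nearGeometricLaw 0 = 3503946 / 4000000 ∧
    (diffLaw nearGeometricLaw 1 = 225491 / 4000000 ∧
      diffLaw nearGeometricLaw (-1) = 225491 / 4000000) ∧
    (diffLaw nearGeometricLaw 2 = 20668 / 4000000 ∧
      diffLaw nearGeometricLaw (-2) = 20668 / 4000000) ∧
    (diffLaw nearGeometricLaw 3 = 1868 / 4000000 ∧
      diffLaw nearGeometricLaw (-3) = 1868 / 4000000) := by
  obtain ⟨p0, p1, p2, p3⟩ := nearGeometricLaw_apply
  obtain ⟨v0, v1, v2, v3⟩ := val_fin_three_add_one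
  simp only [diffLaw, sum_filter, Fintype.sum_prod_type, sum_fin_three_add_one, p0, p1, p2, p3, v0,
    v1, v2, v3]
  norm_num

set_option exponentiation.threshold 400 in
theorem theoremT :
    ∃ α : FractionalDilate,
      α.IsFractionalSet ∧
      1 < α.size ∧
      (α.addDilate (-1) α).IsSpartan ∧
      (α.addDilate 1 α).size ≤ α.size ^ (1.7354 : ℝ) := by
  have l2 := Real.log_two_lt_d9
  have l2' := Real.log_two_gt_d9
  obtain ⟨p0, p1, p2, p3⟩ := nearGeometricLaw_apply
  obtain ⟨v0, v1, v2, v3⟩ := val_fin_three_add_one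
  -- The mean is 0.0725, just below m. The binding bound on h is half the difference entropy (about
  -- 0.5018 / 2); the entropy itself is about 0.265. The best w is near 2m / (1 + 2m) ≈ 0.127; 1/8
  -- makes log w a multiple of log 2.
  refine FractionalDilate.exists_isSpartan_sub_of_entropy (M := 3) (p := nearGeometricLaw)
    (h := 0.2508) (m := 0.07251) (w := 1 / 8)
    ?_ ?_ (by norm_num) (by norm_num) (by norm_num) (by norm_num) ?_ ?_ ?_ ?_
  · intro i
    fin_cases i <;> norm_num [nearGeometricLaw]
  · rw [sum_fin_three_add_one, p0, p1, p2, p3]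
    norm_num
  · rw [sum_fin_three_add_one, p0, p1, p2, p3, v0, v1, v2, v3]
    norm_num
  · have a0 := log_le_neg_div_mul_log_two (x := 1868 / 2000) (a := 3) (b := 31)
      (by norm_num) (by norm_num) (by norm_num)
    have a1 := log_le_neg_div_mul_log_two (x := 120 / 2000) (a := 69) (b := 17)
      (by norm_num) (by norm_num) (by norm_num)
    have a2 := log_le_neg_div_mul_log_two (x := 11 / 2000) (a := 15) (b := 2)
      (by norm_num) (by norm_num) (by norm_num)
    have a3 := log_le_neg_div_mul_log_two (x := 1 / 2000) (a := 10) (b := 1)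
      (by norm_num) (by norm_num) (by norm_num)
    rw [sum_fin_three_add_one, p0, p1, p2, p3]
    norm_num only at a0 a1 a2 a3 ⊢
    linarith
  · obtain ⟨d0, ⟨d1, d1'⟩, ⟨d2, d2'⟩, d3, d3'⟩ := diffLaw_nearGeometricLaw
    have a0 := log_le_neg_div_mul_log_two (x := 3503946 / 4000000) (a := 17) (b := 89)
      (by norm_num) (by norm_num) (by norm_num)
    have a1 := log_le_neg_div_mul_log_two (x := 225491 / 4000000) (a := 307) (b := 74)
      (by norm_num) (by norm_num) (by norm_num)
    have a2 := log_le_neg_div_mul_log_two (x := 20668 / 4000000) (a := 281) (b := 37)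
      (by norm_num) (by norm_num) (by norm_num)
    have a3 := log_le_neg_div_mul_log_two (x := 1868 / 4000000) (a := 177) (b := 16)
      (by norm_num) (by norm_num) (by norm_num)
    simp only [Fintype.sum_prod_type, sum_fin_three_add_one, v0, v1, v2, v3, Nat.cast_zero,
      Nat.cast_one, Nat.cast_ofNat]
    norm_num only [d0, d1, d1', d2, d2', d3, d3', p0, p1, p2, p3]
    norm_num only at a0 a1 a2 a3 ⊢
    linarith
  · have a0 := log_le_div_mul_log_two (x := 299593 / 262144) (a := 21) (b := 109)
      (by norm_num) (by norm_num) (by norm_num)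
    have e : ∑ k : Fin (2 * 3 + 1), (1 / 8 : ℝ) ^ (k : ℕ) = 299593 / 262144 := by
      norm_num [Fin.sum_univ_succ]
    have e2 : -Real.log (1 / 8) = 3 * Real.log 2 := by
      rw [one_div, Real.log_inv, neg_neg, show (8 : ℝ) = 2 ^ 3 by norm_num, Real.log_pow]
      norm_num
    rw [e, e2]
    norm_num only at a0 ⊢
    linarith
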